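/- Conventions. Valuations are written additively, with values in $\Gamma\cup\{\infty\}$ for a totally ordered abelian group $\Gamma$; a pseudo-valuation of $K[x]$ may take the value $\infty$ at nonzero polynomials. For a valuation $\mu$ of $K[x]$, $f$ and $g$ are $\mu$-equivalent if $\mu(f-g)>\mu(f)$, and $f$ $\mu$-divides $g$ if $g$ is $\mu$-equivalent to a multiple of $f$. A key polynomial for $\mu$ is a monic $\phi$ that does not $\mu$-divide $1$, that is $\mu$-irreducible (if $\phi$ $\mu$-divides $gh$, it $\mu$-divides $g$ or $h$) and $\mu$-minimal (if $\phi$ $\mu$-divides $g$ then $\deg\phi\le\deg g$). For $\gamma>\mu(\phi)$, possibly $\gamma=\infty$, the augmented valuation $[\mu;\mu'(\phi)=\gamma]$ is $\mu'(\sum_i a_i\phi^i)=\min_i(\mu(a_i)+i\gamma)$, where $\deg a_i<\deg\phi$. The same formula, with $\mu$ replaced by a valuation $\nu$ of $K$, $\phi$ monic of degree $1$ and $a_i\in K$, defines $[\nu;\mu'(\phi)=\gamma]$. A continuous family over $\mu$ is a family $(\mu_\alpha)_{\alpha\in A}$ indexed by a totally ordered set $A$ without maximum, with $\mu_\alpha=[\mu;\mu_\alpha(\phi_\alpha)=\gamma_\alpha]$,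 $\gamma_\alpha<\infty$, all $\phi_\alpha$ being key polynomials for $\mu$ of the same degree, such that for $\alpha<\beta$ one has $\gamma_\alpha<\gamma_\beta$, $\phi_\beta$ is a key polynomial for $\mu_\alpha$ and $\mu_\beta=[\mu_\alpha;\mu_\beta(\phi_\beta)=\gamma_\beta]$. A limit key polynomial for it is a monic polynomial of minimal degree among those $\phi$ for which $\mu_\alpha(\phi)$ is not eventually constant; for $\gamma$ greater than all $\mu_\alpha(\phi)$, possibly $\gamma=\infty$, the limit augmented valuation $[(\mu_\alpha)_{\alpha\in A};\mu'(\phi)=\gamma]$ is $\mu'(\sum_i a_i\phi^i)=\min_i(\mu_A(a_i)+i\gamma)$, where $\deg a_i<\deg\phi$ and $\mu_A(a)$ is the eventual value of $\mu_\alpha(a)$. A simple admissible family $\mathcal S=(\mu_1,\dots,\mu_n;(\mu_\alpha)_{\alpha\in A})$, $n\ge1$, comes with data $(\phi_i,\gamma_i)$ such that $\mu_i=[\mu_{i-1};\mu_i(\phi_i)=\gamma_i]$ and $\deg\phi_i>\deg\phi_{i-1}$ for $2\le i\le n$, and $(\mu_\alpha)_{\alpha\in A}$ is a (possibly empty) continuous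 family over $\mu_n$ with $\deg\phi_\alpha=\deg\phi_n$. An admissible family over a valuation $\nu$ of $K$ (with a largest element) is $\mathcal A=\mathcal S^{(1)}\cup\dots\cup\mathcal S^{(N)}$, $N\ge1$, where the $\mathcal S^{(j)}$ are simple admissible families, $\mu^{(1)}_1=[\nu;\mu_1^{(1)}(\phi_1^{(1)})=\gamma_1^{(1)}]$ with $\deg\phi^{(1)}_1=1$; for $2\le j\le N$ the set $A^{(j-1)}$ is nonempty and $\mu_1^{(j)}$ is a limit augmented valuation of $(\mu^{(j-1)}_\alpha)_{\alpha\in A^{(j-1)}}$ for a limit key polynomial $\phi_1^{(j)}$; $A^{(N)}=\emptyset$; and all values $\gamma$ in the data are finite except possibly that of the largest element. Its jumps are the rational numbers $S^{(j-1)}(\mathcal A)$, $2\le j\le N$, with $\deg\phi^{(j)}_1=S^{(j-1)}(\mathcal A)\deg\phi^{(j-1)}_\alpha$ for $\alpha\in A^{(j-1)}$. (Exhaustiveness of the continuous families is not required.) Proposition 1. Let $K^*=K(z)$ be a finite primitive extension of a field $K$, let $\nu$ be a valuation of $K$ and $\nu^*$ an extension of $\nu$ to $K^*$. Let $f$ be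 the minimal polynomial of $z$ over $K$. Let $\mathcal A=\mathcal S^{(1)}\cup\dots\cup\mathcal S^{(N)}$ be any admissible family over $\nu$ that represents $\nu^*$, i.e. whose largest element is the pseudo-valuation $g\mapsto\nu^*(g(z))$ of $K[x]$, defined with the polynomial $f$ and the value $\infty$. If the set $\nu^*(z-K)=\{\nu^*(z-a)\mid a\in K\}$ has no largest element (so that $z\notin K$), then $N\ge2$, and $\mathcal A$ has a nontrivial jump: $S^{(j-1)}(\mathcal A)>1$ for some $2\le j\le N$. -/

import Mathlib

open Polynomial

universe u v w

namespace MacLaneVaquie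

variable {K : Type u} [Field K] {Γ : Type v} [AddCommGroup Γ] [LinearOrder Γ]
  [IsOrderedAddMonoid Γ]

/-! Valuations are written additively with values in `Γ ∪ {∞}`.  An `AddValuation` on `K[X]` may
take the value `∞` on nonzero polynomials, so it is a pseudo-valuation in general. -/

/-- `f` and `g` are `μ`-equivalent: `μ (f - g) > μ f` (hence also `μ f = μ g < ∞`), that is, they
have the same nonzero initial form in the graded algebra of `μ`. -/
def MuEquiv (μ : AddValuation K[X] (WithTop Γ)) (f g : K[X]) : Prop :=
  μ f < μ (f - g)

/-- `f` `μ`-divides `g`: `g` is `μ`-equivalent to a multiple of `f`. -/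
def MuDvd (μ : AddValuation K[X] (WithTop Γ)) (f g : K[X]) : Prop :=
  ∃ h : K[X], MuEquiv μ g (f * h)

/-- A (MacLane–Vaquié) key polynomial for `μ`: monic, `μ`-minimal and `μ`-irreducible. -/
structure IsKeyPolynomial (μ : AddValuation K[X] (WithTop Γ)) (φ : K[X]) : Prop where
  monic : φ.Monic
  minimal : ∀ g : K[X], MuDvd μ φ g → φ.degree ≤ g.degree
  not_unit : ¬ MuDvd μ φ 1
  irreducible : ∀ g h : K[X], MuDvd μ φ (g * h) → MuDvd μ φ g ∨ MuDvd μ φ h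

/-- `μ' = [μ ; μ' φ = γ]` is the augmented valuation of `μ` for the key polynomial `φ` and the
value `γ > μ φ` (possibly `γ = ∞`): on the `φ`-adic expansion `∑ aᵢ φ ^ i`, with
`deg aᵢ < deg φ`, it takes the value `minᵢ (μ aᵢ + i γ)`. -/
structure IsAugmented (μ : AddValuation K[X] (WithTop Γ)) (φ : K[X]) (γ : WithTop Γ)
    (μ' : AddValuation K[X] (WithTop Γ)) : Prop where
  key : IsKeyPolynomial μ φ
  lt : μ φ < γ
  eq_min : ∀ (s : ℕ) (a : ℕ → K[X]), (∀ i, (a i).degree < φ.degree) →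
    μ' (∑ i ∈ Finset.range s, a i * φ ^ i) =
      (Finset.range s).inf fun i => μ (a i) + i • γ

/-- `μ' = [ν ; μ' φ = γ]` where `ν` is a valuation of the field `K` and `φ` is monic of degree
one: `μ' (∑ cᵢ φ ^ i) = minᵢ (ν cᵢ + i γ)` for constants `cᵢ ∈ K`. -/
structure IsAugmentedOfField (ν : AddValuation K (WithTop Γ)) (φ : K[X]) (γ : WithTop Γ)
    (μ' : AddValuation K[X] (WithTop Γ)) : Prop where
  monic : φ.Monic
  degree_eq_one : φ.degree = 1
  eq_min : ∀ (s : ℕ) (c : ℕ → K),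
    μ' (∑ i ∈ Finset.range s, C (c i) * φ ^ i) =
      (Finset.range s).inf fun i => ν (c i) + i • γ

/-- A continuous family of iterated augmented valuations over `μ`, all of whose key polynomials
have degree `d`, indexed by a totally ordered set `A` without maximum.  The set `A` may be empty
here. -/
structure IsContinuousFamily (μ : AddValuation K[X] (WithTop Γ)) (d : ℕ) {A : Type w}
    [LinearOrder A] (μA : A → AddValuation K[X] (WithTop Γ)) (φA : A → K[X])
    (γA : A → WithTop Γ) : Prop where
  no_max : ∀ α : A, ∃ β : A, α < β
  natDegree_eq : ∀ α, (φA α).natDegree = d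
  ne_top : ∀ α, γA α ≠ ⊤
  base : ∀ α, IsAugmented μ (φA α) (γA α) (μA α)
  strictMono : StrictMono γA
  step : ∀ α β, α < β → IsAugmented (μA α) (φA β) (γA β) (μA β)

/-- Along the family `μA`, the value of `f` is eventually equal to `c`. -/
def HasStableValue {A : Type w} [LinearOrder A] (μA : A → AddValuation K[X] (WithTop Γ))
    (f : K[X]) (c : WithTop Γ) : Prop :=
  ∃ α₀ : A, ∀ α, α₀ ≤ α → μA α f = c

/-- A limit key polynomial for the family `μA`: a monic polynomial of minimal degree among those
whose value is not eventually constant. -/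
structure IsLimitKeyPolynomial {A : Type w} [LinearOrder A]
    (μA : A → AddValuation K[X] (WithTop Γ)) (φ : K[X]) : Prop where
  monic : φ.Monic
  unstable : ¬ ∃ c, HasStableValue μA φ c
  minimal : ∀ g : K[X], g.degree < φ.degree → ∃ c, HasStableValue μA g c

/-- `μ' = [(μ_α)_α ; μ' φ = γ]` is the limit augmented valuation of the family `μA` for the limit
key polynomial `φ` and the value `γ > μ_α φ` for all `α` (possibly `γ = ∞`). -/
structure IsLimitAugmented {A : Type w} [LinearOrder A]
    (μA : A → AddValuation K[X] (WithTop Γ)) (φ : K[X]) (γ : WithTop Γ)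
    (μ' : AddValuation K[X] (WithTop Γ)) : Prop where
  key : IsLimitKeyPolynomial μA φ
  lt : ∀ α, μA α φ < γ
  eq_min : ∀ (s : ℕ) (a : ℕ → K[X]) (c : ℕ → WithTop Γ), (∀ i, (a i).degree < φ.degree) →
    (∀ i, HasStableValue μA (a i) (c i)) →
    μ' (∑ i ∈ Finset.range s, a i * φ ^ i) =
      (Finset.range s).inf fun i => c i + i • γ

variable (K Γ) in
/-- A simple admissible family `(μ₁, …, μₙ ; (μ_α)_{α ∈ A})`, `n = m + 1 ≥ 1`: the discrete part
`μ₁, …, μₙ` consists of successive augmented valuations with key polynomials of strictly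
increasing degrees (indices are shifted to `0, …, m`; how the first one arises is not prescribed
here), and the continuous part is a (possibly empty) continuous family of iterated augmented
valuations over `μₙ` with key polynomials of the same degree as that of `μₙ`.  No exhaustiveness
or maximality of the set of values `γ_α` is required. -/
structure SimpleFamily where
  m : ℕ
  μ : Fin (m + 1) → AddValuation K[X] (WithTop Γ)
  φ : Fin (m + 1) → K[X]
  γ : Fin (m + 1) → WithTop Γ
  augmented : ∀ i : Fin m,
    IsAugmented (μ i.castSucc) (φ i.succ) (γ i.succ) (μ i.succ)
  degree_lt : ∀ i : Fin m, (φ i.castSucc).degree < (φ i.succ).degree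
  A : Type w
  [ord : LinearOrder A]
  μA : A → AddValuation K[X] (WithTop Γ)
  φA : A → K[X]
  γA : A → WithTop Γ
  continuous : IsContinuousFamily (μ (Fin.last m)) (φ (Fin.last m)).natDegree μA φA γA

attribute [instance] SimpleFamily.ord

/-- An admissible family `S⁽¹⁾ ∪ ⋯ ∪ S⁽ᴺ⁾` of valuations of `K[X]` over the valuation `ν` of `K`,
with a largest element, where `N = r + 1 ≥ 1` (the simple subfamilies are indexed by
`0, …, r`).  The first valuation of `S⁽¹⁾` is `[ν ; φ ↦ γ]` with `φ` of degree one; the first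
valuation of each later simple family is a limit augmented valuation for the continuous part of
the preceding one, which is nonempty; the last simple family has no continuous part; and only the
largest element of the family may be a pseudo-valuation. -/
structure AdmissibleFamily (ν : AddValuation K (WithTop Γ)) where
  r : ℕ
  S : Fin (r + 1) → SimpleFamily.{u, v, w} K Γ
  first : IsAugmentedOfField ν ((S 0).φ 0) ((S 0).γ 0) ((S 0).μ 0)
  nonempty : ∀ j : Fin r, Nonempty (S j.castSucc).A
  limit : ∀ j : Fin r,
    IsLimitAugmented (S j.castSucc).μA ((S j.succ).φ 0) ((S j.succ).γ 0) ((S j.succ).μ 0)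
  isEmpty_last : IsEmpty (S (Fin.last r)).A
  ne_top : ∀ (j : Fin (r + 1)) (i : Fin ((S j).m + 1)),
    (j ≠ Fin.last r ∨ i ≠ Fin.last (S j).m) → (S j).γ i ≠ ⊤

namespace AdmissibleFamily

variable {ν : AddValuation K (WithTop Γ)} (𝒜 : AdmissibleFamily.{u, v, w} ν)

/-- The number `N` of simple subfamilies. -/
def N : ℕ := 𝒜.r + 1

/-- The jump between two consecutive simple subfamilies: the degree of the limit key polynomial
defining the first valuation of the second one, divided by the common degree of the key
polynomials of the continuous part of the first one. -/
def jump (j : Fin 𝒜.r) : ℚ :=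
  (((𝒜.S j.succ).φ 0).natDegree : ℚ) /
    (((𝒜.S j.castSucc).φ (Fin.last (𝒜.S j.castSucc).m)).natDegree : ℚ)

/-- The last simple subfamily. -/
def lastSimple : SimpleFamily.{u, v, w} K Γ := 𝒜.S (Fin.last 𝒜.r)

/-- The admissible family represents the valuation `νs` of `L = K(z)`: its largest element is the
pseudo-valuation `g ↦ νs (g(z))` of `K[X]`, which is `νs` on `K[X]/(f) ≅ L`, and it is defined by
the minimal polynomial `f` of `z` with the value `∞`. -/
structure Represents {L : Type*} [Field L] [Algebra K L] (z : L)
    (νs : AddValuation L (WithTop Γ)) : Prop where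
  φ_last : 𝒜.lastSimple.φ (Fin.last 𝒜.lastSimple.m) = minpoly K z
  γ_last : 𝒜.lastSimple.γ (Fin.last 𝒜.lastSimple.m) = ⊤
  μ_last : ∀ g : K[X], 𝒜.lastSimple.μ (Fin.last 𝒜.lastSimple.m) g = νs (aeval z g)

end AdmissibleFamily

end MacLaneVaquie

namespace MacLaneVaquie

section

variable {K : Type u} [Field K] {Γ : Type v} [AddCommGroup Γ] [LinearOrder Γ]
  [IsOrderedAddMonoid Γ]

/-! Argue by contraposition: if every jump is at most 1, then the values `μ (X - C a)`, for `a` in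
`K`, have a largest element for each `μ` in the discrete parts. A key polynomial of degree one
creates such a maximum at its own root. A later augmentation has a key polynomial of degree greater
than 1 and leaves linear polynomials unchanged. Only a continuous family of degree 1 followed by a
limit key polynomial of higher degree could destroy the maximum, and that is a jump greater than 1.
For the largest valuation of the family these values are `νs (z - a)`, contradicting `hmax`. The
induction is `SimpleFamily.hasLinearMax` within a simple family and `AdmissibleFamily.hasLinearMax`
across limits. -/

/-- The values of `μ` on the monic polynomials of degree one have a largest element. -/
def HasLinearMax (μ : AddValuation K[X] (WithTop Γ)) : Prop :=
  ∃ b : K, ∀ a : K, μ (X - C a) ≤ μ (X - C b)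

theorem HasLinearMax.congr {μ μ' : AddValuation K[X] (WithTop Γ)} (h : HasLinearMax μ)
    (heq : ∀ a : K, μ' (X - C a) = μ (X - C a)) : HasLinearMax μ' := by
  obtain ⟨b, hb⟩ := h
  exact ⟨b, fun a => by rw [heq, heq]; exact hb a⟩

/-- An augmented valuation agrees with the original one below the degree of the key polynomial. -/
theorem IsAugmented.apply_of_degree_lt {μ μ' : AddValuation K[X] (WithTop Γ)} {φ : K[X]}
    {γ : WithTop Γ} (h : IsAugmented μ φ γ μ') {g : K[X]} (hg : g.degree < φ.degree) :
    μ' g = μ g := by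
  simpa using h.eq_min 1 (fun _ => g) fun _ => hg

theorem IsLimitAugmented.apply_of_degree_lt {A : Type w} [LinearOrder A]
    {μA : A → AddValuation K[X] (WithTop Γ)} {φ : K[X]} {γ : WithTop Γ}
    {μ' : AddValuation K[X] (WithTop Γ)} (h : IsLimitAugmented μA φ γ μ') {g : K[X]}
    {c : WithTop Γ} (hg : g.degree < φ.degree) (hc : HasStableValue μA g c) : μ' g = c := by
  simpa using h.eq_min 1 (fun _ => g) (fun _ => c) (fun _ => hg) fun _ => hc

theorem exists_eq_X_sub_C_of_monic {φ : K[X]} (hφ : φ.Monic) (h1 : φ.natDegree = 1) :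
    ∃ b : K, φ = X - C b :=
  ⟨-φ.coeff 0, by rw [C_neg, sub_neg_eq_add]; exact hφ.eq_X_add_C h1⟩

theorem IsAugmentedOfField.hasLinearMax {ν : AddValuation K (WithTop Γ)} {φ : K[X]}
    {γ : WithTop Γ} {μ' : AddValuation K[X] (WithTop Γ)} (h : IsAugmentedOfField ν φ γ μ') :
    HasLinearMax μ' := by
  obtain ⟨b, rfl⟩ := exists_eq_X_sub_C_of_monic h.monic
    (natDegree_eq_of_degree_eq_some h.degree_eq_one)
  have key : ∀ a : K, μ' (X - C a) = min (ν (b - a)) γ := fun a => by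
    -- The expansion `X - a = (b - a) + 1 * (X - b)`; at `a = b` the constant term has value `⊤`, so
    -- the minimum is its upper bound `γ`.
    have := h.eq_min 2 fun i => if i = 0 then b - a else 1
    simpa [Finset.sum_range_succ, Finset.range_add_one, min_comm] using this
  exact ⟨b, fun a => by simp [key]⟩

theorem hasStableValue_of_forall {A : Type w} [LinearOrder A] [Nonempty A]
    {μA : A → AddValuation K[X] (WithTop Γ)} {f : K[X]} {c : WithTop Γ}
    (h : ∀ α, μA α f = c) : HasStableValue μA f c :=
  ⟨Classical.arbitrary A, fun α _ => h α⟩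

/-- A monic polynomial of degree 0 is 1, whose value is constantly 0. -/
theorem IsLimitKeyPolynomial.natDegree_pos {A : Type w} [LinearOrder A] [Nonempty A]
    {μA : A → AddValuation K[X] (WithTop Γ)} {φ : K[X]} (h : IsLimitKeyPolynomial μA φ) :
    1 ≤ φ.natDegree := by
  by_contra! hlt
  have h1 : φ = 1 := h.monic.natDegree_eq_zero.mp (by omega)
  exact h.unstable ⟨0, hasStableValue_of_forall fun α => by rw [h1, AddValuation.map_one]⟩

/-- A limit augmented valuation for a limit key polynomial of degree one attains its largest
value on linear polynomials at that key polynomial. -/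
theorem IsLimitAugmented.hasLinearMax {A : Type w} [LinearOrder A] [Nonempty A]
    {μA : A → AddValuation K[X] (WithTop Γ)} {φ : K[X]} {γ : WithTop Γ}
    {μ' : AddValuation K[X] (WithTop Γ)} (h : IsLimitAugmented μA φ γ μ')
    (h1 : φ.natDegree = 1) : HasLinearMax μ' := by
  obtain ⟨b, rfl⟩ := exists_eq_X_sub_C_of_monic h.key.monic h1
  have hdeg : ∀ c : K, (C c).degree < (X - C b).degree := fun c => by
    rw [degree_X_sub_C]
    exact degree_C_lt
  have key : ∀ (a : K) (c : WithTop Γ), HasStableValue μA (C (b - a)) c →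
      μ' (X - C a) = min c γ := fun a c hc => by
    have := h.eq_min 2 (fun i => if i = 0 then C (b - a) else C 1)
      (fun i => if i = 0 then c else 0)
      (fun i => by split_ifs <;> exact hdeg _)
      (fun i => by
        split_ifs
        · exact hc
        · exact hasStableValue_of_forall fun α => by rw [C_1, AddValuation.map_one])
    simpa [Finset.sum_range_succ, Finset.range_add_one, min_comm] using this
  refine ⟨b, fun a => ?_⟩
  obtain ⟨c, hc⟩ := h.key.minimal _ (hdeg (b - a))
  -- At `a = b` the constant coefficient is 0, with stable value `⊤`, so the value there is `γ`,
  -- which bounds every `min c γ`.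
  rw [key a c hc, key b ⊤ (hasStableValue_of_forall fun α => by simp)]
  simp

/-- Degrees increase strictly from at least 1, so every key polynomial after the first has degree
greater than 1 and its augmentation fixes the values of linear polynomials. -/
theorem SimpleFamily.hasLinearMax (S : SimpleFamily.{u, v, w} K Γ) (hdeg : 1 ≤ (S.φ 0).degree)
    (hmax : HasLinearMax (S.μ 0)) (i : Fin (S.m + 1)) :
    1 ≤ (S.φ i).degree ∧ HasLinearMax (S.μ i) := by
  induction i using Fin.induction with
  | zero => exact ⟨hdeg, hmax⟩
  | succ i ih =>
    have hlt := ih.1.trans_lt (S.degree_lt i)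
    exact ⟨hlt.le, ih.2.congr fun a =>
      (S.augmented i).apply_of_degree_lt ((degree_X_sub_C a).trans_lt hlt)⟩

/-- Below the common degree of its key polynomials, a continuous family is constant. -/
theorem IsContinuousFamily.hasStableValue {μ : AddValuation K[X] (WithTop Γ)} {d : ℕ}
    {A : Type w} [LinearOrder A] [Nonempty A] {μA : A → AddValuation K[X] (WithTop Γ)}
    {φA : A → K[X]} {γA : A → WithTop Γ} (h : IsContinuousFamily μ d μA φA γA) {g : K[X]}
    (hg : g.degree < d) : HasStableValue μA g (μ g) :=
  hasStableValue_of_forall fun α => (h.base α).apply_of_degree_lt <| by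
    rwa [degree_eq_natDegree (h.base α).key.monic.ne_zero, h.natDegree_eq α]

/-- Carries the maximum across each limit augmentation; the bound on the jumps is needed only when
the limit key polynomial is nonlinear. -/
theorem AdmissibleFamily.hasLinearMax {ν : AddValuation K (WithTop Γ)}
    (𝒜 : AdmissibleFamily.{u, v, w} ν) (hjump : ∀ j, 𝒜.jump j ≤ 1) (j : Fin (𝒜.r + 1)) :
    1 ≤ ((𝒜.S j).φ 0).degree ∧ HasLinearMax ((𝒜.S j).μ 0) := by
  induction j using Fin.induction with
  | zero => exact ⟨𝒜.first.degree_eq_one.ge, 𝒜.first.hasLinearMax⟩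
  | succ j ih =>
    have := 𝒜.nonempty j
    have hlim := 𝒜.limit j
    have hpos := hlim.key.natDegree_pos
    have hdeg : 1 ≤ ((𝒜.S j.succ).φ 0).degree := by
      rw [degree_eq_natDegree hlim.key.monic.ne_zero]
      exact_mod_cast hpos
    refine ⟨hdeg, ?_⟩
    obtain ⟨hlast, hmax⟩ :=
      (𝒜.S j.castSucc).hasLinearMax ih.1 ih.2 (Fin.last (𝒜.S j.castSucc).m)
    -- Positivity of the denominator of the jump, so that jump at most 1 is a comparison of degrees.
    have hlast' : 1 ≤ ((𝒜.S j.castSucc).φ (Fin.last (𝒜.S j.castSucc).m)).natDegree :=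
      le_natDegree_of_coe_le_degree hlast
    have hle : ((𝒜.S j.succ).φ 0).natDegree ≤
        ((𝒜.S j.castSucc).φ (Fin.last (𝒜.S j.castSucc).m)).natDegree := by
      have := hjump j
      rw [jump, div_le_one (by exact_mod_cast hlast')] at this
      exact_mod_cast this
    rcases hpos.eq_or_lt with h1 | h1
    · exact hlim.hasLinearMax h1.symm
    -- Here the continuous family has degree at least that of the limit key polynomial, hence
    -- greater than 1: neither it nor the limit changes linear values.
    · refine hmax.congr fun a => hlim.apply_of_degree_lt ?_ <|
        (𝒜.S j.castSucc).continuous.hasStableValue ?_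
      · rw [degree_X_sub_C, degree_eq_natDegree hlim.key.monic.ne_zero]
        exact_mod_cast h1
      · rw [degree_X_sub_C]
        exact_mod_cast h1.trans_le hle

end

end MacLaneVaquie

theorem proposition1 {K : Type*} {L : Type*} [Field K] [Field L] [Algebra K L]
    [FiniteDimensional K L] (z : L) (hz : IntermediateField.adjoin K {z} = ⊤)
    {Γ : Type*} [AddCommGroup Γ] [LinearOrder Γ] [IsOrderedAddMonoid Γ]
    (ν : AddValuation K (WithTop Γ)) (νs : AddValuation L (WithTop Γ))
    (hext : ∀ a : K, νs (algebraMap K L a) = ν a)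
    (hmax : ¬ ∃ c, IsGreatest (Set.range fun a : K => νs (z - algebraMap K L a)) c)
    (𝒜 : MacLaneVaquie.AdmissibleFamily ν) (h𝒜 : 𝒜.Represents z νs) :
    2 ≤ 𝒜.N ∧ ∃ j : Fin 𝒜.r, 1 < 𝒜.jump j := by
  have hex : ∃ j : Fin 𝒜.r, 1 < 𝒜.jump j := by
    by_contra! hjump
    obtain ⟨hdeg, hlin⟩ := 𝒜.hasLinearMax hjump (Fin.last 𝒜.r)
    obtain ⟨b, hb⟩ := ((𝒜.S (Fin.last 𝒜.r)).hasLinearMax hdeg hlin (Fin.last _)).2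
    have hval : ∀ a : K, (𝒜.S (Fin.last 𝒜.r)).μ (Fin.last _) (X - C a) =
        νs (z - algebraMap K L a) := fun a => by
      have := h𝒜.μ_last (X - C a)
      rwa [map_sub (aeval (R := K) z), aeval_X, aeval_C] at this
    refine hmax ⟨νs (z - algebraMap K L b), ⟨b, rfl⟩, ?_⟩
    rintro _ ⟨a, rfl⟩
    simpa only [hval] using hb a
  obtain ⟨j, hj⟩ := hex
  -- An index `j` in `Fin 𝒜.r` forces `𝒜.r` to be positive, and `N = r + 1`.
  exact ⟨by have := j.pos; unfold MacLaneVaquie.AdmissibleFamily.N; omega, j, hj⟩
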